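/- Let $x,y\in\mathbb{R}$ satisfy $x^2+y^2-x-y+xy=0$ and $-\tfrac13\le x\le 1$, and let $$C=\begin{pmatrix} x & y & 1-x-y\\ 1-x-y & x & y\\ y & 1-x-y & x\end{pmatrix}$$ (the set of all such matrices is denoted $\mathcal{X}$). Assume $x\neq 0,1$. Consider the three-state discrete-time quantum walk on $\mathbb{Z}$ with coin $C$: on $\ell^2(\mathbb{Z})\otimes\mathbb{C}^3$ one step is $U=\mathsf{S}(I\otimes C)$, where $$\mathsf{S}=\sum_{m\in\mathbb{Z}}\bigl(|m-1\rangle\langle m|\otimes|1\rangle\langle 1|+|m\rangle\langle m|\otimes|2\rangle\langle 2|+|m+1\rangle\langle m|\otimes|3\rangle\langle 3|\bigr).$$ The walk starts at the origin, $\psi(0)=|0\rangle\otimes(\alpha,\beta,\gamma)^T$ with $\alpha,\beta,\gamma\in\mathbb{C}$, $|\alpha|^2+|\beta|^2+|\gamma|^2=1$; put $\psi(t)=U^t\psi(0)=\sum_{m,l}\psi_l(m,t)\,|m\rangle\otimes|l\rangle$ and $P(m,t)=\sum_{l=1}^3|\psi_l(m,t)|^2$. Then the following are equivalent: 1. $\lim_{t\to\infty}P(0,t)=0$;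 2. $(\alpha,\beta,\gamma)^T$ is a complex multiple of $(1-x-y,\,-(1-x),\,y)^T$; 3. $(\alpha,\beta,\gamma)^T=\frac{u}{N}\,(1-x-y,\,-(1-x),\,y)^T$ for some $u\in\mathbb{C}$ with $|u|=1$, where $N=\sqrt{(1-x-y)^2+(1-x)^2+y^2}$; 4. $A=B=0$, where $A=\alpha(1-x)+\beta(1-x-y)$ and $B=\gamma(1-x)+\beta y$. For every other initial coin state the walk localizes at the origin, that is, $\lim_{t\to\infty}P(0,t)$ exists and is positive. -/

import Mathlib

/-! Three-state discrete-time quantum walk on the line. -/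

noncomputable section

namespace ThreeStateWalk

/-- The coin space `ℂ³` with its Hermitian norm; the coordinates `0, 1, 2` are the chiralities
left, centre and right. -/
abbrev CoinSpace : Type := EuclideanSpace ℂ (Fin 3)

/-- The state space `ℓ²(ℤ) ⊗ ℂ³`, realised as `ℓ²(ℤ; ℂ³)`: the vector `f m` collects the three
probability amplitudes at the position `m`. -/
abbrev StateSpace : Type := lp (fun _ : ℤ => CoinSpace) 2

theorem memlp_iff (f : ℤ → CoinSpace) :
    Memℓp f 2 ↔ Summable fun m => ‖f m‖ ^ 2 := by
  rw [memℓp_gen_iff (by norm_num)]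
  norm_num

theorem memlp_coin (C : Matrix (Fin 3) (Fin 3) ℂ) (f : StateSpace) :
    Memℓp (fun m => Matrix.toEuclideanCLM (𝕜 := ℂ) C (f m)) 2 := by
  rw [memlp_iff]
  have hf := ((memlp_iff f).1 f.2).mul_left (‖Matrix.toEuclideanCLM (𝕜 := ℂ) C‖ ^ 2)
  refine Summable.of_nonneg_of_le (fun m => by positivity) (fun m => ?_) hf
  rw [← mul_pow]
  gcongr
  exact ContinuousLinearMap.le_opNorm _ _

theorem norm_shift_sq_le (u v w : CoinSpace) :
    ‖(!₂[u 0, v 1, w 2] : CoinSpace)‖ ^ 2 ≤ ‖u‖ ^ 2 + ‖v‖ ^ 2 + ‖w‖ ^ 2 := by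
  have hu := PiLp.norm_apply_le u 0
  have hv := PiLp.norm_apply_le v 1
  have hw := PiLp.norm_apply_le w 2
  have h : ‖(!₂[u 0, v 1, w 2] : CoinSpace)‖ ^ 2 = ‖u 0‖ ^ 2 + ‖v 1‖ ^ 2 + ‖w 2‖ ^ 2 := by
    simp [EuclideanSpace.norm_sq_eq, Fin.sum_univ_three]
  rw [h]
  gcongr

theorem memlp_shift (f : StateSpace) :
    Memℓp (fun m : ℤ => (!₂[f (m + 1) 0, f m 1, f (m - 1) 2] : CoinSpace)) 2 := by
  rw [memlp_iff]
  have hf := (memlp_iff f).1 f.2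
  have h1 : Summable fun m : ℤ => ‖f (m + 1)‖ ^ 2 :=
    hf.comp_injective (add_left_injective (1 : ℤ))
  have h2 : Summable fun m : ℤ => ‖f (m - 1)‖ ^ 2 :=
    hf.comp_injective (sub_left_injective (b := (1 : ℤ)))
  exact Summable.of_nonneg_of_le (fun m => sq_nonneg _)
    (fun m => norm_shift_sq_le (f (m + 1)) (f m) (f (m - 1))) ((h1.add hf).add h2)

/-- The operator `I ⊗ C`: the coin `C` acts on the amplitude vector of every position. -/
def coinOp (C : Matrix (Fin 3) (Fin 3) ℂ) : StateSpace →ₗ[ℂ] StateSpace where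
  toFun f := ⟨fun m => Matrix.toEuclideanCLM (𝕜 := ℂ) C (f m), memlp_coin C f⟩
  map_add' f g := by
    ext1; funext m
    exact map_add (Matrix.toEuclideanCLM (𝕜 := ℂ) C) (f m) (g m)
  map_smul' c f := by
    ext1; funext m
    exact map_smul (Matrix.toEuclideanCLM (𝕜 := ℂ) C) c (f m)

/-- The conditional shift
`S = ∑ₘ (|m-1⟩⟨m| ⊗ |1⟩⟨1| + |m⟩⟨m| ⊗ |2⟩⟨2| + |m+1⟩⟨m| ⊗ |3⟩⟨3|)`:
the left component at `m` comes from `m + 1`, the right component from `m - 1`. -/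
def shiftOp : StateSpace →ₗ[ℂ] StateSpace where
  toFun f := ⟨fun m => !₂[f (m + 1) 0, f m 1, f (m - 1) 2], memlp_shift f⟩
  map_add' f g := by
    ext m i
    fin_cases i <;> rfl
  map_smul' c f := by
    ext m i
    fin_cases i <;> rfl

/-- One step `U = S (I ⊗ C)` of the walk with coin `C`. -/
def stepOp (C : Matrix (Fin 3) (Fin 3) ℂ) : StateSpace →ₗ[ℂ] StateSpace :=
  shiftOp ∘ₗ coinOp C

/-- The state `ψ(t) = Uᵗ ψ(0)` of the walk that starts at the origin with coin state `φ`, that is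
with `ψ(0) = |0⟩ ⊗ φ`. -/
def state (C : Matrix (Fin 3) (Fin 3) ℂ) (φ : CoinSpace) (t : ℕ) : StateSpace :=
  (stepOp C ^ t) (lp.single 2 0 φ)

/-- The probability `P(m, t) = ∑ₗ |ψₗ(m, t)|²` of finding the walker at `m` at time `t`. -/
def prob (C : Matrix (Fin 3) (Fin 3) ℂ) (φ : CoinSpace) (m : ℤ) (t : ℕ) : ℝ :=
  ∑ l : Fin 3, ‖state C φ t m l‖ ^ 2

/-- The walk localizes at `m`: the limit of `P(m, t)` as `t → ∞` exists and is positive. -/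
def LocalizesAt (C : Matrix (Fin 3) (Fin 3) ℂ) (φ : CoinSpace) (m : ℤ) : Prop :=
  ∃ p : ℝ, 0 < p ∧ Filter.Tendsto (fun t : ℕ => prob C φ m t) Filter.atTop (nhds p)

/-- The matrix with parameters `x, y`. -/
def coin (x y : ℝ) : Matrix (Fin 3) (Fin 3) ℂ :=
  !![(x : ℂ), (y : ℂ), 1 - x - y;
     1 - x - y, (x : ℂ), (y : ℂ);
     (y : ℂ), 1 - x - y, (x : ℂ)]

/-- The family `𝒳` of generalized Grover coins. -/
def coinsX : Set (Matrix (Fin 3) (Fin 3) ℂ) :=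
  {C | ∃ x y : ℝ, x ^ 2 + y ^ 2 - x - y + x * y = 0 ∧ -(1 / 3) ≤ x ∧ x ≤ 1 ∧ C = coin x y}

/-- The vector `(1 - x - y, -(1 - x), y)ᵀ`. -/
def escapeVec (x y : ℝ) : CoinSpace :=
  !₂[(1 - x - y : ℂ), -(1 - x : ℂ), (y : ℂ)]

end ThreeStateWalk

end

open MeasureTheory Filter Topology Complex

/-! The Fourier transform turns the walk into unitary 3×3 matrices `momentumStep x y k`, with
eigenvalues `1` and `exp (±iθ(k))`, where `2 cos θ(k) = x (1 + 2 cos k) - 1`. Since `x ≠ 0`, the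
phase `θ` is not flat, so the two moving bands contribute oscillatory integrals that vanish as `t →
∞` by Riemann–Lebesgue. Only the flat band `1` survives: the amplitude at the origin tends to
`limitVec`, the average over `k` of the projection of the coin state onto `fixedVec`, and `P(0,t)`
tends to its squared norm.

That limit is zero exactly when `A = B = 0`. The overlap with the flat band is `exp (-ik) A + B`,
and pairing `limitVec` with `(A, 0, B)` gives the average of `|A + B exp (ik)|²` against a positive
weight (`fixedPart_pairing`). If it vanishes, so does `A + B exp (ik)` for every `k` in `[-π, π]`.
The rest is linear algebra: `A = B = 0` cuts out the line spanned by `escapeVec`. -/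

/-- Riemann–Lebesgue for a phase that is injective with nonvanishing derivative. -/
theorem tendsto_setIntegral_exp_phase_smul {E : Type*} [NormedAddCommGroup E] [NormedSpace ℂ E]
    {s : Set ℝ} (hs : MeasurableSet s) {θ θ' : ℝ → ℝ}
    (hθ : ∀ k ∈ s, HasDerivWithinAt θ (θ' k) s k) (hinj : Set.InjOn θ s)
    (hθ' : ∀ k ∈ s, θ' k ≠ 0) (f : ℝ → E) {a : ℝ} (ha : a ≠ 0) :
    Tendsto (fun t : ℕ => ∫ k in s, exp (((a * t * θ k : ℝ) : ℂ) * I) • f k) atTop (𝓝 0) := by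
  -- The frequency carries `-1/(2π)` because `Real.fourierChar v` is `exp (2πiv)`.
  have hlim : Tendsto (fun t : ℕ => -(a * t) / (2 * Real.pi)) atTop (cocompact ℝ) := by
    have h1 : Tendsto (fun t : ℕ => (-a / (2 * Real.pi)) * (t : ℝ)) atTop (cocompact ℝ) := by
      have hne : -a / (2 * Real.pi) ≠ 0 :=
        div_ne_zero (neg_ne_zero.2 ha) (mul_ne_zero two_ne_zero Real.pi_ne_zero)
      exact (Homeomorph.mulLeft₀ _ hne).isClosedEmbedding.tendsto_cocompact.comp
        (tendsto_natCast_atTop_atTop.mono_right atTop_le_cocompact)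
    refine h1.congr fun t => by ring
  set g : ℝ → ℝ := Function.invFunOn θ s with hg
  have hgl : ∀ k ∈ s, g (θ k) = k := fun k hk => hinj.leftInvOn_invFunOn hk
  -- Density of `f` in the variable `u = θ k`. It need not be integrable: Bochner integrals then
  -- default to `0`, and Riemann–Lebesgue still holds.
  set F : ℝ → E := (θ '' s).indicator fun u => |θ' (g u)|⁻¹ • f (g u) with hF
  have hms : MeasurableSet (θ '' s) :=
    measurable_image_of_fderivWithin hs (fun k hk => (hθ k hk).hasFDerivWithinAt) hinj
  refine ((Real.tendsto_integral_exp_smul_cocompact F).comp hlim).congr fun t => ?_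
  have h2 : (fun v : ℝ => Real.fourierChar (-(v * (-(a * t) / (2 * Real.pi)))) • F v) =
      (θ '' s).indicator fun u => exp (((a * t * u : ℝ) : ℂ) * I) •
        (|θ' (g u)|⁻¹ • f (g u)) := by
    funext v
    by_cases hv : v ∈ θ '' s
    · simp only [hF, Set.indicator_of_mem hv, Circle.smul_def, Real.fourierChar_apply]
      congr 3
      have : (Real.pi : ℂ) ≠ 0 := by exact_mod_cast Real.pi_ne_zero
      push_cast
      field_simp
    · simp [hF, Set.indicator_of_notMem hv]
  simp only [Function.comp]
  rw [h2, integral_indicator hms, integral_image_eq_integral_abs_deriv_smul hs hθ hinj]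
  refine setIntegral_congr_fun hs fun k hk => ?_
  have hne : |θ' k| ≠ 0 := abs_ne_zero.2 (hθ' k hk)
  simp only [hgl k hk]
  rw [smul_comm, smul_smul, mul_inv_cancel₀ hne, one_smul]

/-! ### Isometries annihilated by a quadratic polynomial -/

section

variable {E : Type*} [NormedAddCommGroup E] [InnerProductSpace ℂ E]

theorem pow_apply_of_eigenvector (U : E →L[ℂ] E) {w : E} {μ : ℂ} (h : U w = μ • w) (t : ℕ) :
    (U ^ t) w = μ ^ t • w := by
  induction t with
  | zero => simp
  | succ t ih => rw [pow_succ', mul_apply_eq_comp, ih, map_smul, h, smul_smul, pow_succ]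

/-- As `(U - μ)(U - ν)` kills `w`, the vector `(U - ν) w` is a `μ`-eigenvector. -/
theorem map_sub_smul_of_quadratic (U : E →L[ℂ] E) {w : E} {μ ν : ℂ} (hμν : μ * ν = 1)
    (h : U (U w) = (μ + ν) • U w - w) : U (U w - ν • w) = μ • (U w - ν • w) := by
  rw [map_sub, h, map_smul, smul_sub, smul_smul, hμν, add_smul, one_smul]
  abel

/-- The powers of `U` on a vector annihilated by `(U - μ) (U - ν)`. -/
theorem pow_apply_of_quadratic (U : E →L[ℂ] E) {w : E} {μ ν : ℂ} (hμν : μ * ν = 1) (hne : μ ≠ ν)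
    (h : U (U w) = (μ + ν) • U w - w) (t : ℕ) :
    (U ^ t) w = μ ^ t • ((μ - ν)⁻¹ • (U w - ν • w)) + ν ^ t • ((ν - μ)⁻¹ • (U w - μ • w)) := by
  have h1 := pow_apply_of_eigenvector U (map_sub_smul_of_quadratic U hμν h) t
  have h2 := pow_apply_of_eigenvector U
    (map_sub_smul_of_quadratic U ((mul_comm ν μ).trans hμν) (by rw [h, add_comm])) t
  have h3 : w = (μ - ν)⁻¹ • ((U w - ν • w) - (U w - μ • w)) := by
    rw [eq_inv_smul_iff₀ (sub_ne_zero.2 hne), sub_smul]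
    abel
  conv_lhs => rw [h3]
  rw [map_smul, map_sub, h1, h2, smul_sub, smul_comm, smul_comm (μ - ν)⁻¹ (ν ^ t),
    ← neg_sub μ ν, inv_neg, neg_smul, smul_neg, sub_eq_add_neg]

/-- If `U` preserves the inner product, the two eigencomponents are bounded by the vector. -/
theorem norm_eigencomponent_le (U : E →L[ℂ] E) (hU : ∀ a b, inner ℂ (U a) (U b) = inner ℂ a b)
    {w : E} {μ ν : ℂ} (hμν : μ * ν = 1) (hconj : starRingEnd ℂ μ = ν) (hne : μ ≠ ν)
    (h : U (U w) = (μ + ν) • U w - w) :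
    ‖(μ - ν)⁻¹ • (U w - ν • w)‖ ≤ ‖w‖ := by
  set p := U w - ν • w with hp
  set q := U w - μ • w with hq
  have h1 : U p = μ • p := map_sub_smul_of_quadratic U hμν h
  have h2 : U q = ν • q :=
    map_sub_smul_of_quadratic U ((mul_comm ν μ).trans hμν) (by rw [h, add_comm])
  -- Isometry gives `⟨p, q⟩ = ν² ⟨p, q⟩`, and `ν² = 1` would force `μ = ν`. Pythagoras for `p - q =
  -- (μ - ν) w` then yields the bound.
  have horth : inner ℂ p q = 0 := by
    have h3 := hU p q
    rw [h1, h2, inner_smul_left, inner_smul_right, hconj] at h3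
    have h4 : (ν * ν - 1) * inner ℂ p q = 0 := by linear_combination h3
    rcases mul_eq_zero.1 h4 with h5 | h5
    · refine absurd ?_ hne
      have hν : ν ≠ 0 := right_ne_zero_of_mul_eq_one hμν
      exact mul_right_cancel₀ hν (by linear_combination hμν - h5)
    · exact h5
  have h3 : p - q = (μ - ν) • w := by rw [hp, hq, sub_smul]; abel
  have h4 : ‖p‖ ≤ ‖(μ - ν) • w‖ := by
    rw [← h3]
    have h5 := norm_sub_sq (𝕜 := ℂ) p q
    rw [horth] at h5
    refine le_of_sq_le_sq ?_ (norm_nonneg _)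
    rw [h5]
    simp
  rw [norm_smul, norm_inv, inv_mul_le_iff₀ (norm_pos_iff.2 (sub_ne_zero.2 hne)), ← norm_smul]
  exact h4

end

/-! ### The walk in momentum space -/

namespace ThreeStateWalk

/-- One step of the walk in momentum space. -/
noncomputable def momentumStep (x y k : ℝ) : CoinSpace →L[ℂ] CoinSpace :=
  Matrix.toEuclideanCLM (𝕜 := ℂ)
    (Matrix.diagonal ![exp (k * I), 1, exp (-(k * I))] * coin x y)

/-- The vector fixed by `momentumStep x y k`. -/
noncomputable def fixedVec (x y k : ℝ) : CoinSpace :=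
  !₂[(1 - x : ℂ) * exp (k * I), (1 - x - y : ℂ) * exp (k * I) + y, (1 - x : ℂ)]

theorem momentumStep_apply (x y k : ℝ) (φ : CoinSpace) :
    momentumStep x y k φ =
      !₂[exp (k * I) * (x * φ 0 + y * φ 1 + (1 - x - y) * φ 2),
        (1 - x - y) * φ 0 + x * φ 1 + y * φ 2,
        exp (-(k * I)) * (y * φ 0 + (1 - x - y) * φ 1 + x * φ 2)] := by
  ext i
  fin_cases i <;>
    simp [momentumStep, coin, Matrix.mulVec, dotProduct, Fin.sum_univ_three, mul_add]

/-- The two brackets are the quantities `A` and `B` of the main theorem, so the overlap is a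
trigonometric polynomial with these coefficients. -/
theorem inner_fixedVec (x y k : ℝ) (φ : CoinSpace) :
    inner ℂ (fixedVec x y k) φ =
      exp (-(k * I)) * (φ 0 * (1 - x) + φ 1 * (1 - x - y)) + (φ 2 * (1 - x) + φ 1 * y) := by
  simp [fixedVec, PiLp.inner_apply, Fin.sum_univ_three, ← exp_conj]
  ring

theorem inner_eq (a b : CoinSpace) : inner ℂ a b =
    b 0 * starRingEnd ℂ (a 0) + b 1 * starRingEnd ℂ (a 1) + b 2 * starRingEnd ℂ (a 2) := by
  simp [PiLp.inner_apply, Fin.sum_univ_three]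

variable {x y : ℝ}

theorem cast_relation (h : x ^ 2 + y ^ 2 - x - y + x * y = 0) :
    (x : ℂ) ^ 2 + (y : ℂ) ^ 2 - x - y + x * y = 0 := by exact_mod_cast h

theorem exp_mul_exp_neg (k : ℝ) : exp (k * I) * exp (-(k * I)) = 1 := by
  rw [← exp_add, add_neg_cancel, exp_zero]

theorem inner_momentumStep (h : x ^ 2 + y ^ 2 - x - y + x * y = 0) (k : ℝ) (a b : CoinSpace) :
    inner ℂ (momentumStep x y k a) (momentumStep x y k b) = inner ℂ a b := by
  have h' := cast_relation h
  have he := exp_mul_exp_neg k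
  simp [inner_eq, momentumStep_apply, ← exp_conj]
  generalize exp (k * I) = e at *
  generalize exp (-(k * I)) = f at *
  grind

theorem momentumStep_fixedVec (h : x ^ 2 + y ^ 2 - x - y + x * y = 0) (k : ℝ) :
    momentumStep x y k (fixedVec x y k) = fixedVec x y k := by
  have h' := cast_relation h
  have he := exp_mul_exp_neg k
  ext i
  fin_cases i <;> simp [momentumStep_apply, fixedVec] <;>
  generalize exp (k * I) = e at * <;>
  generalize exp (-(k * I)) = f at * <;>
  grind

theorem inner_fixedVec_self (h : x ^ 2 + y ^ 2 - x - y + x * y = 0) (k : ℝ) :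
    inner ℂ (fixedVec x y k) (fixedVec x y k) =
      (((1 - x) * (3 - x * (1 + 2 * Real.cos k)) : ℝ) : ℂ) := by
  have h' := cast_relation h
  have he := exp_mul_exp_neg k
  have hc : 2 * Complex.cos k = exp (k * I) + exp (-(k * I)) := by
    rw [Complex.two_cos, neg_mul]
  rw [inner_fixedVec]
  push_cast
  simp [hc, fixedVec]
  generalize exp (k * I) = e at *
  generalize exp (-(k * I)) = f at *
  grind

/-- The quadratic factor of the characteristic polynomial of `momentumStep` has rank one. -/
theorem quadratic_momentumStep (h : x ^ 2 + y ^ 2 - x - y + x * y = 0) (k : ℝ) (φ : CoinSpace) :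
    (1 - x : ℂ) • (momentumStep x y k (momentumStep x y k φ) +
        ((1 - x * (1 + 2 * Real.cos k) : ℝ) : ℂ) • momentumStep x y k φ + φ) =
      inner ℂ (fixedVec x y k) φ • fixedVec x y k := by
  have h' := cast_relation h
  have he := exp_mul_exp_neg k
  have hc : 2 * Complex.cos k = exp (k * I) + exp (-(k * I)) := by
    rw [Complex.two_cos, neg_mul]
  rw [inner_fixedVec]
  push_cast
  rw [hc]
  ext i
  fin_cases i <;> simp [momentumStep_apply, fixedVec] <;>
  generalize exp (k * I) = e at * <;>
  generalize exp (-(k * I)) = f at * <;>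
  generalize φ.ofLp 0 = a at * <;>
  generalize φ.ofLp 1 = b at * <;>
  generalize φ.ofLp 2 = c at * <;>
  grind

theorem continuous_momentumStep_apply (x y : ℝ) {g : ℝ → CoinSpace} (hg : Continuous g) :
    Continuous fun k => momentumStep x y k (g k) := by
  have hi : ∀ i, Continuous fun k => g k i := fun i =>
    (EuclideanSpace.proj (𝕜 := ℂ) i).continuous.comp hg
  simp only [momentumStep_apply]
  refine (PiLp.continuous_toLp 2 _).comp (continuous_pi fun i => ?_)
  have h0 := hi 0
  have h1 := hi 1
  have h2 := hi 2
  fin_cases i <;> simp <;> fun_prop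

theorem continuous_momentumStep_pow (x y : ℝ) (φ : CoinSpace) (t : ℕ) :
    Continuous fun k => (momentumStep x y k ^ t) φ := by
  induction t with
  | zero => simpa using continuous_const
  | succ t ih =>
    simp only [pow_succ', mul_apply_eq_comp]
    exact continuous_momentumStep_apply x y ih

/-! ### Fourier inversion -/

theorem integral_exp_int_mul (m : ℤ) :
    ∫ k in (-Real.pi)..Real.pi, exp ((m : ℂ) * k * I) = if m = 0 then 2 * (Real.pi : ℂ) else 0 := by
  split_ifs with hm
  · subst hm
    simp
    ring
  · have hc : (m : ℂ) * I ≠ 0 := mul_ne_zero (by exact_mod_cast hm) I_ne_zero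
    have h := integral_exp_mul_complex (a := -Real.pi) (b := Real.pi) hc
    have h2 : ∀ k : ℝ, (m : ℂ) * k * I = (m : ℂ) * I * k := fun k => by ring
    simp only [h2]
    rw [h, div_eq_zero_iff]
    left
    rw [sub_eq_zero, exp_eq_exp_iff_exists_int]
    exact ⟨m, by push_cast; ring⟩

theorem stepOp_apply_zero (C : Matrix (Fin 3) (Fin 3) ℂ) (f : StateSpace) (m : ℤ) :
    stepOp C f m 0 = Matrix.toEuclideanCLM (𝕜 := ℂ) C (f (m + 1)) 0 := rfl

theorem stepOp_apply_one (C : Matrix (Fin 3) (Fin 3) ℂ) (f : StateSpace) (m : ℤ) :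
    stepOp C f m 1 = Matrix.toEuclideanCLM (𝕜 := ℂ) C (f m) 1 := rfl

theorem stepOp_apply_two (C : Matrix (Fin 3) (Fin 3) ℂ) (f : StateSpace) (m : ℤ) :
    stepOp C f m 2 = Matrix.toEuclideanCLM (𝕜 := ℂ) C (f (m - 1)) 2 := rfl

theorem momentumStep_apply_coord (x y k : ℝ) (φ : CoinSpace) (i : Fin 3) :
    momentumStep x y k φ i = (![exp (k * I), 1, exp (-(k * I))] : Fin 3 → ℂ) i *
      Matrix.toEuclideanCLM (𝕜 := ℂ) (coin x y) φ i := by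
  simp [momentumStep, Matrix.mulVec_diagonal]

/-- The state of the walk is the inverse Fourier transform of the momentum-space evolution. -/
theorem state_eq_integral (x y : ℝ) (φ : CoinSpace) (t : ℕ) (m : ℤ) :
    state (coin x y) φ t m = (2 * Real.pi : ℂ)⁻¹ •
      ∫ k in (-Real.pi)..Real.pi, exp ((m : ℂ) * k * I) • (momentumStep x y k ^ t) φ := by
  have hpi : (2 * Real.pi : ℂ) ≠ 0 := by exact_mod_cast (by positivity : (2 * Real.pi : ℝ) ≠ 0)
  induction t generalizing m with
  | zero =>
    simp only [state, pow_zero, Module.End.one_apply, one_apply_eq_self]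
    rw [intervalIntegral.integral_smul_const, integral_exp_int_mul]
    by_cases hm : m = 0
    · subst hm
      rw [if_pos rfl, smul_smul, inv_mul_cancel₀ hpi, one_smul, lp.single_apply_self]
    · rw [if_neg hm, zero_smul, smul_zero, lp.single_apply_ne _ _ _ hm]
  | succ t ih =>
    have hcont : ∀ (n : ℤ) (s : ℕ), Continuous fun k : ℝ =>
        exp ((n : ℂ) * k * I) • (momentumStep x y k ^ s) φ := fun n s =>
      Continuous.smul (f := fun k : ℝ => exp ((n : ℂ) * k * I)) (by fun_prop)
        (continuous_momentumStep_pow x y φ s)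
    have hcoord : ∀ (n : ℤ) (i : Fin 3),
        Matrix.toEuclideanCLM (𝕜 := ℂ) (coin x y) (state (coin x y) φ t n) i =
        (2 * Real.pi : ℂ)⁻¹ * ∫ k in (-Real.pi)..Real.pi, exp ((n : ℂ) * k * I) *
          Matrix.toEuclideanCLM (𝕜 := ℂ) (coin x y) ((momentumStep x y k ^ t) φ) i := by
      intro n i
      have h := ContinuousLinearMap.intervalIntegral_comp_comm
        ((EuclideanSpace.proj (𝕜 := ℂ) i).comp (Matrix.toEuclideanCLM (𝕜 := ℂ) (coin x y)))
        ((hcont n t).intervalIntegrable (μ := volume) (-Real.pi) Real.pi)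
      rw [ih n, map_smul, PiLp.smul_apply, smul_eq_mul]
      congr 1
      refine h.symm.trans ?_
      simp
    have hstep : state (coin x y) φ (t + 1) = stepOp (coin x y) (state (coin x y) φ t) := by
      rw [state, pow_succ']
      rfl
    ext i
    have h := ContinuousLinearMap.intervalIntegral_comp_comm (EuclideanSpace.proj (𝕜 := ℂ) i)
        ((hcont m (t + 1)).intervalIntegrable (μ := volume) (-Real.pi) Real.pi)
    have hR : ((2 * Real.pi : ℂ)⁻¹ • ∫ k in (-Real.pi)..Real.pi,
        exp ((m : ℂ) * k * I) • (momentumStep x y k ^ (t + 1)) φ) i =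
        (2 * Real.pi : ℂ)⁻¹ * ∫ k in (-Real.pi)..Real.pi, exp ((m : ℂ) * k * I) *
          ((![exp (k * I), 1, exp (-(k * I))] : Fin 3 → ℂ) i *
          Matrix.toEuclideanCLM (𝕜 := ℂ) (coin x y) ((momentumStep x y k ^ t) φ) i) := by
      rw [PiLp.smul_apply, smul_eq_mul]
      congr 1
      refine h.symm.trans ?_
      simp only [pow_succ', mul_apply_eq_comp, map_smul, PiLp.proj_apply,
        momentumStep_apply_coord, smul_eq_mul]
    rw [hR, hstep]
    fin_cases i
    -- Reading the left component from `m + 1` multiplies the integrand by `exp (ik)`; the right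
    -- component, from `m - 1`, gets `exp (-ik)`.
    · refine (stepOp_apply_zero _ _ _).trans ?_
      rw [hcoord]
      congr 2
      funext k
      rw [← mul_assoc]
      congr 1
      simp [← exp_add]
      ring_nf
    · refine (stepOp_apply_one _ _ _).trans ?_
      rw [hcoord]
      simp
    · refine (stepOp_apply_two _ _ _).trans ?_
      rw [hcoord]
      congr 2
      funext k
      rw [← mul_assoc]
      congr 1
      simp [← exp_add]
      ring_nf

/-! ### Dispersion relation and spectral splitting -/

/-- The argument of the nontrivial eigenvalues of `momentumStep x y k`. -/
noncomputable def phase (x k : ℝ) : ℝ := Real.arccos ((x * (1 + 2 * Real.cos k) - 1) / 2)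

/-- The component of `φ` fixed by `momentumStep x y k`. -/
noncomputable def fixedPart (x y : ℝ) (φ : CoinSpace) (k : ℝ) : CoinSpace :=
  (inner ℂ (fixedVec x y k) φ / inner ℂ (fixedVec x y k) (fixedVec x y k)) • fixedVec x y k

theorem band_pos (hx : -(1 / 3) ≤ x) (hx1 : x < 1) (k : ℝ) :
    0 < 3 - x * (1 + 2 * Real.cos k) := by
  nlinarith [Real.cos_le_one k, Real.neg_one_le_cos k]

/-- Since `1 + 2 cos k` lies in `[-1, 3]`, the bound `-1/3 ≤ x` is what keeps the argument of
`arccos` above `-1`. -/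
theorem phase_arg_mem (hx : -(1 / 3) ≤ x) (hx1 : x < 1) (k : ℝ) :
    (x * (1 + 2 * Real.cos k) - 1) / 2 ∈ Set.Icc (-1 : ℝ) 1 := by
  constructor <;> nlinarith [Real.cos_le_one k, Real.neg_one_le_cos k]

theorem cos_phase (hx : -(1 / 3) ≤ x) (hx1 : x < 1) (k : ℝ) :
    Real.cos (phase x k) = (x * (1 + 2 * Real.cos k) - 1) / 2 :=
  Real.cos_arccos (phase_arg_mem hx hx1 k).1 (phase_arg_mem hx hx1 k).2

theorem phase_arg_mem_Ioo (hx : -(1 / 3) ≤ x) (hx1 : x < 1) {k : ℝ} (hk : Real.sin k ≠ 0) :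
    (x * (1 + 2 * Real.cos k) - 1) / 2 ∈ Set.Ioo (-1 : ℝ) 1 := by
  have h1 : Real.cos k ^ 2 < 1 := by
    have := Real.sin_sq_add_cos_sq k
    have := sq_pos_of_ne_zero hk
    linarith
  have h2 := (sq_lt_one_iff_abs_lt_one _).1 h1
  rw [abs_lt] at h2
  constructor <;> rcases le_or_gt 0 x with h | h <;> nlinarith [h2.1, h2.2]

theorem continuous_phase (x : ℝ) : Continuous (phase x) := by
  unfold phase
  exact Real.continuous_arccos.comp (by fun_prop)

theorem hasDerivAt_phase (hx : -(1 / 3) ≤ x) (hx1 : x < 1) {k : ℝ} (hk : Real.sin k ≠ 0) :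
    HasDerivAt (phase x)
      (-(1 / √(1 - ((x * (1 + 2 * Real.cos k) - 1) / 2) ^ 2)) * (x * -Real.sin k)) k := by
  have h := phase_arg_mem_Ioo hx hx1 hk
  have h2 : HasDerivAt (fun k => (x * (1 + 2 * Real.cos k) - 1) / 2) (x * -Real.sin k) k := by
    have h3 := (((((Real.hasDerivAt_cos k).const_mul 2).const_add 1).const_mul x).sub_const
      1).div_const 2
    exact h3.congr_deriv (by ring)
  exact (Real.hasDerivAt_arccos h.1.ne' h.2.ne).comp k h2

theorem deriv_phase_ne_zero (hx : -(1 / 3) ≤ x) (hx1 : x < 1) (hx0 : x ≠ 0) {k : ℝ}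
    (hk : Real.sin k ≠ 0) :
    -(1 / √(1 - ((x * (1 + 2 * Real.cos k) - 1) / 2) ^ 2)) * (x * -Real.sin k) ≠ 0 := by
  have h := phase_arg_mem_Ioo hx hx1 hk
  have h2 : 0 < 1 - ((x * (1 + 2 * Real.cos k) - 1) / 2) ^ 2 := by nlinarith [h.1, h.2]
  exact mul_ne_zero (neg_ne_zero.2 (one_div_ne_zero (Real.sqrt_pos.2 h2).ne'))
    (mul_ne_zero hx0 (neg_ne_zero.2 hk))

theorem injOn_phase (hx : -(1 / 3) ≤ x) (hx1 : x < 1) (hx0 : x ≠ 0) {s : Set ℝ}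
    (hs : Set.InjOn Real.cos s) : Set.InjOn (phase x) s := by
  intro k hk l hl h
  refine hs hk hl (mul_left_cancel₀ hx0 ?_)
  have h2 := congrArg Real.cos h
  rw [cos_phase hx hx1, cos_phase hx hx1] at h2
  linarith

theorem exp_phase_ne (hx : -(1 / 3) ≤ x) (hx1 : x < 1) {k : ℝ} (hk : Real.sin k ≠ 0) :
    exp (phase x k * I) ≠ exp (-(phase x k * I)) := by
  intro h
  have h1 := congrArg Complex.im h
  rw [← neg_mul, ← ofReal_neg, exp_ofReal_mul_I_im, exp_ofReal_mul_I_im, Real.sin_neg] at h1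
  have h2 : Real.sin (phase x k) = 0 := by linarith
  have h3 := Real.sin_sq_add_cos_sq (phase x k)
  rw [h2, cos_phase hx hx1] at h3
  have h4 := phase_arg_mem_Ioo hx hx1 hk
  nlinarith [h4.1, h4.2]

theorem inner_fixedVec_self_ne_zero (h : x ^ 2 + y ^ 2 - x - y + x * y = 0) (hx : -(1 / 3) ≤ x)
    (hx1 : x < 1) (k : ℝ) : inner ℂ (fixedVec x y k) (fixedVec x y k) ≠ 0 := by
  rw [inner_fixedVec_self h]
  exact_mod_cast (mul_pos (sub_pos.2 hx1) (band_pos hx hx1 k)).ne'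

theorem continuous_fixedVec (x y : ℝ) : Continuous (fixedVec x y) := by
  refine (PiLp.continuous_toLp 2 _).comp (continuous_pi fun i => ?_)
  fin_cases i <;> simp <;> fun_prop

theorem continuous_fixedPart (h : x ^ 2 + y ^ 2 - x - y + x * y = 0) (hx : -(1 / 3) ≤ x)
    (hx1 : x < 1) (φ : CoinSpace) : Continuous (fixedPart x y φ) := by
  have hv := continuous_fixedVec x y
  exact ((hv.inner continuous_const).div (hv.inner hv)
    (inner_fixedVec_self_ne_zero h hx hx1)).smul hv

theorem momentumStep_pow_fixedPart (h : x ^ 2 + y ^ 2 - x - y + x * y = 0) (φ : CoinSpace)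
    (k : ℝ) (t : ℕ) : (momentumStep x y k ^ t) (fixedPart x y φ k) = fixedPart x y φ k := by
  have h1 : momentumStep x y k (fixedPart x y φ k) = (1 : ℂ) • fixedPart x y φ k := by
    rw [fixedPart, map_smul, momentumStep_fixedVec h, one_smul]
  simpa using pow_apply_of_eigenvector _ h1 t

/-- The remainder is orthogonal to `fixedVec`, so the rank-one right side of
`quadratic_momentumStep` vanishes on it. -/
theorem quadratic_sub_fixedPart (h : x ^ 2 + y ^ 2 - x - y + x * y = 0) (hx : -(1 / 3) ≤ x)
    (hx1 : x < 1) (φ : CoinSpace) (k : ℝ) :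
    momentumStep x y k (momentumStep x y k (φ - fixedPart x y φ k)) =
      (exp (phase x k * I) + exp (-(phase x k * I))) • momentumStep x y k (φ - fixedPart x y φ k)
        - (φ - fixedPart x y φ k) := by
  have horth : inner ℂ (fixedVec x y k) (φ - fixedPart x y φ k) = 0 := by
    rw [inner_sub_right, fixedPart, inner_smul_right,
      div_mul_cancel₀ _ (inner_fixedVec_self_ne_zero h hx hx1 k), sub_self]
  have hq := quadratic_momentumStep h k (φ - fixedPart x y φ k)
  rw [horth, zero_smul, smul_eq_zero] at hq
  have hne : (1 - x : ℂ) ≠ 0 := by exact_mod_cast (sub_pos.2 hx1).ne'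
  have hq := hq.resolve_left hne
  have hsum : exp (phase x k * I) + exp (-(phase x k * I)) =
      -((1 - x * (1 + 2 * Real.cos k) : ℝ) : ℂ) := by
    rw [← neg_mul, ← Complex.two_cos, ← ofReal_cos, cos_phase hx hx1]
    push_cast
    ring
  rw [hsum, neg_smul, eq_sub_iff_add_eq, eq_neg_iff_add_eq_zero]
  rw [← hq]
  abel

/-! ### Decay of the moving bands and the limiting amplitude -/

theorem tendsto_setIntegral_momentumStep_pow (h : x ^ 2 + y ^ 2 - x - y + x * y = 0)
    (hx : -(1 / 3) ≤ x) (hx1 : x < 1) (hx0 : x ≠ 0) (φ : CoinSpace) {s : Set ℝ}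
    (hs : MeasurableSet s) (hsb : Bornology.IsBounded s) (hsin : ∀ k ∈ s, Real.sin k ≠ 0)
    (hcos : Set.InjOn Real.cos s) :
    Tendsto (fun t : ℕ => ∫ k in s, (momentumStep x y k ^ t) (φ - fixedPart x y φ k))
      atTop (𝓝 0) := by
  set w : ℝ → CoinSpace := fun k => φ - fixedPart x y φ k with hw
  have hwc : Continuous w := continuous_const.sub (continuous_fixedPart h hx hx1 φ)
  have hUw : Continuous fun k => momentumStep x y k (w k) := continuous_momentumStep_apply x y hwc
  have hθ := continuous_phase x
  set μ : ℝ → ℂ := fun k => exp (phase x k * I) with hμ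
  set ν : ℝ → ℂ := fun k => exp (-(phase x k * I)) with hν
  have hμc : Continuous μ := by fun_prop
  have hνc : Continuous ν := by fun_prop
  have hμν : ∀ k, μ k * ν k = 1 := fun k => exp_mul_exp_neg _
  have hconj : ∀ k, starRingEnd ℂ (μ k) = ν k := fun k => by
    simp [hμ, hν, ← exp_conj]
  have hconj' : ∀ k, starRingEnd ℂ (ν k) = μ k := fun k => by rw [← hconj, Complex.conj_conj]
  have hne : ∀ k ∈ s, μ k ≠ ν k := fun k hk => exp_phase_ne hx hx1 (hsin k hk)
  have hquad : ∀ k, momentumStep x y k (momentumStep x y k (w k)) =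
      (μ k + ν k) • momentumStep x y k (w k) - w k := quadratic_sub_fixedPart h hx hx1 φ
  set p : ℝ → CoinSpace := fun k => (μ k - ν k)⁻¹ • (momentumStep x y k (w k) - ν k • w k)
  set q : ℝ → CoinSpace := fun k => (ν k - μ k)⁻¹ • (momentumStep x y k (w k) - μ k • w k)
  have hwint : IntegrableOn (fun k => ‖w k‖) s :=
    (hwc.norm.locallyIntegrable.integrableOn_isCompact hsb.isCompact_closure).mono_set
      subset_closure
  have hint : ∀ (g : ℝ → ℂ), Continuous g → (∀ k, ‖g k‖ = 1) → ∀ (f : ℝ → CoinSpace),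
      AEStronglyMeasurable f (volume.restrict s) → (∀ k ∈ s, ‖f k‖ ≤ ‖w k‖) →
      IntegrableOn (fun k => g k • f k) s := by
    intro g hg hg1 f hf hfw
    refine Integrable.mono' hwint (hg.aestronglyMeasurable.smul hf) ?_
    refine (ae_restrict_iff' hs).2 (Eventually.of_forall fun k hk => ?_)
    rw [norm_smul, hg1, one_mul]
    exact hfw k hk
  have hμ1 : ∀ k, ‖μ k‖ = 1 := fun k => norm_exp_ofReal_mul_I _
  have hν1 : ∀ k, ‖ν k‖ = 1 := fun k => by rw [← hconj, RCLike.norm_conj, hμ1]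
  have hpm : AEStronglyMeasurable p (volume.restrict s) :=
    ((hμc.sub hνc).measurable.inv.aestronglyMeasurable).smul
      (hUw.sub (hνc.smul hwc)).aestronglyMeasurable
  have hqm : AEStronglyMeasurable q (volume.restrict s) :=
    ((hνc.sub hμc).measurable.inv.aestronglyMeasurable).smul
      (hUw.sub (hμc.smul hwc)).aestronglyMeasurable
  -- The factor `(μ - ν)⁻¹` may blow up near the ends of `s`; unitarity still bounds the components
  -- by `‖w k‖`, making them integrable.
  have hpw : ∀ k ∈ s, ‖p k‖ ≤ ‖w k‖ := fun k hk =>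
    norm_eigencomponent_le _ (inner_momentumStep h k) (hμν k) (hconj k) (hne k hk) (hquad k)
  have hqw : ∀ k ∈ s, ‖q k‖ ≤ ‖w k‖ := fun k hk =>
    norm_eigencomponent_le _ (inner_momentumStep h k) ((mul_comm _ _).trans (hμν k)) (hconj' k)
      (hne k hk).symm (by rw [hquad, add_comm])
  have hsplit : ∀ t : ℕ, ∫ k in s, (momentumStep x y k ^ t) (w k) =
      (∫ k in s, μ k ^ t • p k) + ∫ k in s, ν k ^ t • q k := by
    intro t
    rw [← integral_add (hint (fun k => μ k ^ t) (hμc.pow t) (fun k => by simp [hμ1]) p hpm hpw)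
      (hint (fun k => ν k ^ t) (hνc.pow t) (fun k => by simp [hν1]) q hqm hqw)]
    exact setIntegral_congr_fun hs fun k hk =>
      pow_apply_of_quadratic _ (hμν k) (hne k hk) (hquad k) t
  have hRL := fun (f : ℝ → CoinSpace) (a : ℝ) (ha : a ≠ 0) =>
    tendsto_setIntegral_exp_phase_smul hs
    (fun k hk => (hasDerivAt_phase hx hx1 (hsin k hk)).hasDerivWithinAt)
    (injOn_phase hx hx1 hx0 hcos) (fun k hk => deriv_phase_ne_zero hx hx1 hx0 (hsin k hk)) f ha
  have h1 := (hRL p 1 one_ne_zero).add (hRL q (-1) (by norm_num))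
  rw [add_zero] at h1
  refine h1.congr fun t => ?_
  rw [hsplit]
  congr 1 <;> refine setIntegral_congr_fun hs fun k _ => ?_ <;>
    simp only [hμ, hν, ← exp_nat_mul] <;> congr 2 <;> push_cast <;> ring

/-- The limit of the amplitude vector at the origin. -/
noncomputable def limitVec (x y : ℝ) (φ : CoinSpace) : CoinSpace :=
  (2 * Real.pi : ℂ)⁻¹ • ∫ k in (-Real.pi)..Real.pi, fixedPart x y φ k

theorem tendsto_state (h : x ^ 2 + y ^ 2 - x - y + x * y = 0)
    (hx : -(1 / 3) ≤ x) (hx1 : x < 1) (hx0 : x ≠ 0) (φ : CoinSpace) :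
    Tendsto (fun t : ℕ => (state (coin x y) φ t : ℤ → CoinSpace) 0) atTop
      (𝓝 (limitVec x y φ)) := by
  have hpi := Real.pi_pos
  have hp := continuous_fixedPart h hx hx1 φ
  have hwc : ∀ t : ℕ, Continuous fun k => (momentumStep x y k ^ t) (φ - fixedPart x y φ k) := by
    intro t
    simp only [map_sub, momentumStep_pow_fixedPart h]
    exact (continuous_momentumStep_pow x y φ t).sub hp
  -- Cosine is injective only on each half of the period, and the discarded points `0, ±π`, where
  -- `sin k = 0`, are null.
  have hL := tendsto_setIntegral_momentumStep_pow h hx hx1 hx0 φ (s := Set.Ioo (-Real.pi) 0)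
    measurableSet_Ioo (Metric.isBounded_Ioo _ _)
    (fun k hk => (Real.sin_neg_of_neg_of_neg_pi_lt hk.2 hk.1).ne) (by
      intro k hk l hl hkl
      rw [← Real.cos_neg k, ← Real.cos_neg l] at hkl
      exact neg_injective (Real.injOn_cos ⟨by linarith [hk.2], by linarith [hk.1]⟩
        ⟨by linarith [hl.2], by linarith [hl.1]⟩ hkl))
  have hR := tendsto_setIntegral_momentumStep_pow h hx hx1 hx0 φ (s := Set.Ioo 0 Real.pi)
    measurableSet_Ioo (Metric.isBounded_Ioo _ _)
    (fun k hk => (Real.sin_pos_of_mem_Ioo hk).ne')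
    (Real.injOn_cos.mono Set.Ioo_subset_Icc_self)
  have h1 := ((hL.add hR).const_add (∫ k in (-Real.pi)..Real.pi, fixedPart x y φ k)).const_smul
    (2 * Real.pi : ℂ)⁻¹
  rw [add_zero, add_zero] at h1
  refine h1.congr fun t => ?_
  rw [state_eq_integral]
  congr 1
  rw [← integral_Ioc_eq_integral_Ioo, ← integral_Ioc_eq_integral_Ioo,
    ← intervalIntegral.integral_of_le (by linarith), ← intervalIntegral.integral_of_le hpi.le,
    intervalIntegral.integral_add_adjacent_intervals ((hwc t).intervalIntegrable _ _)
      ((hwc t).intervalIntegrable _ _),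
    ← intervalIntegral.integral_add (hp.intervalIntegrable _ _) ((hwc t).intervalIntegrable _ _)]
  congr 1
  funext k
  rw [map_sub, momentumStep_pow_fixedPart h, add_sub_cancel, Int.cast_zero, zero_mul, zero_mul,
    exp_zero, one_smul]

theorem tendsto_prob (h : x ^ 2 + y ^ 2 - x - y + x * y = 0)
    (hx : -(1 / 3) ≤ x) (hx1 : x < 1) (hx0 : x ≠ 0) (φ : CoinSpace) :
    Tendsto (fun t : ℕ => prob (coin x y) φ 0 t) atTop (𝓝 (‖limitVec x y φ‖ ^ 2)) := by
  refine ((tendsto_state h hx hx1 hx0 φ).norm.pow 2).congr fun t => ?_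
  rw [prob, EuclideanSpace.norm_sq_eq]

/-- Coordinates `0` and `2` of `fixedVec` are `(1 - x) exp (ik)` and `1 - x`, so this pairing is `1
- x` times the conjugate of the overlap, up to normalization. Multiplied by the overlap itself it
becomes a squared modulus. -/
theorem fixedPart_pairing (h : x ^ 2 + y ^ 2 - x - y + x * y = 0)
    (hx : -(1 / 3) ≤ x) (hx1 : x < 1) (φ : CoinSpace) {A B : ℂ}
    (hA : φ 0 * (1 - x) + φ 1 * (1 - x - y) = A) (hB : φ 2 * (1 - x) + φ 1 * y = B) (k : ℝ) :
    starRingEnd ℂ A * fixedPart x y φ k 0 + starRingEnd ℂ B * fixedPart x y φ k 2 =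
      ((normSq (A + B * exp (k * I)) / (3 - x * (1 + 2 * Real.cos k)) : ℝ) : ℂ) := by
  have he := exp_mul_exp_neg k
  have hne : (1 - x : ℂ) ≠ 0 := by exact_mod_cast (sub_pos.2 hx1).ne'
  have hT : ((3 - x * (1 + 2 * Real.cos k) : ℝ) : ℂ) ≠ 0 := by
    exact_mod_cast (band_pos hx hx1 k).ne'
  rw [fixedPart, inner_fixedVec_self h, inner_fixedVec, hA, hB, ofReal_div, normSq_eq_conj_mul_self,
    ofReal_mul]
  generalize ((3 - x * (1 + 2 * Real.cos k) : ℝ) : ℂ) = T at *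
  simp [fixedVec, ← exp_conj]
  generalize exp (k * I) = e at *
  generalize exp (-(k * I)) = f at *
  field_simp
  linear_combination (starRingEnd ℂ A * A - starRingEnd ℂ B * B) * he

theorem limitVec_eq_zero_iff (h : x ^ 2 + y ^ 2 - x - y + x * y = 0)
    (hx : -(1 / 3) ≤ x) (hx1 : x < 1) (φ : CoinSpace) :
    limitVec x y φ = 0 ↔
      φ 0 * (1 - x) + φ 1 * (1 - x - y) = 0 ∧ φ 2 * (1 - x) + φ 1 * y = 0 := by
  have hpi := Real.pi_pos
  constructor
  · intro h0
    have hpi' : (2 * Real.pi : ℂ)⁻¹ ≠ 0 := by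
      exact_mod_cast (by positivity : (2 * Real.pi : ℝ)⁻¹ ≠ 0)
    have hI := (smul_eq_zero.1 h0).resolve_left hpi'
    generalize hA : φ 0 * (1 - x) + φ 1 * (1 - x - y) = A
    generalize hB : φ 2 * (1 - x) + φ 1 * y = B
    have h1 := ContinuousLinearMap.intervalIntegral_comp_comm
      (starRingEnd ℂ A • EuclideanSpace.proj (𝕜 := ℂ) (0 : Fin 3) +
        starRingEnd ℂ B • EuclideanSpace.proj (𝕜 := ℂ) (2 : Fin 3))
      ((continuous_fixedPart h hx hx1 φ).intervalIntegrable (μ := volume) (-Real.pi) Real.pi)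
    rw [hI, map_zero] at h1
    simp only [_root_.add_apply, _root_.smul_apply,
      PiLp.proj_apply, smul_eq_mul, fixedPart_pairing h hx hx1 φ hA hB] at h1
    rw [intervalIntegral.integral_ofReal, ofReal_eq_zero] at h1
    set F : ℝ → ℝ := fun k =>
      normSq (A + B * exp (k * I)) / (3 - x * (1 + 2 * Real.cos k)) with hF
    have hFc : Continuous F := by
      refine Continuous.div (continuous_normSq.comp (by fun_prop)) (by fun_prop)
        fun k => (band_pos hx hx1 k).ne'
    have hzero : ∀ k ∈ Set.Icc (-Real.pi) Real.pi, A + B * exp (k * I) = 0 := by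
      intro k hk
      by_contra hne
      refine (intervalIntegral.integral_pos (by linarith) hFc.continuousOn
        (fun l _ => div_nonneg (normSq_nonneg _) (band_pos hx hx1 l).le)
        ⟨k, hk, div_pos (normSq_pos.2 hne) (band_pos hx hx1 k)⟩).ne' h1
    -- The values at `k = 0` and `k = π` give `A + B = 0` and `A - B = 0`.
    have hz := hzero 0 ⟨by linarith, hpi.le⟩
    have hp := hzero Real.pi ⟨by linarith, le_rfl⟩
    rw [exp_pi_mul_I] at hp
    simp at hz
    constructor
    · linear_combination (hz + hp) / 2
    · linear_combination (hz - hp) / 2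
  · rintro ⟨hA, hB⟩
    have : fixedPart x y φ = 0 := by
      funext k
      simp [fixedPart, inner_fixedVec, hA, hB]
    simp [limitVec, this]

/-! ### Coin parameters and the escaping direction -/

theorem coin_mem_coinsX_iff :
    coin x y ∈ coinsX ↔ x ^ 2 + y ^ 2 - x - y + x * y = 0 ∧ -(1 / 3) ≤ x ∧ x ≤ 1 := by
  constructor
  · rintro ⟨x', y', h, h1, h2, hC⟩
    have hx : x = x' := by simpa [coin] using congrFun (congrFun hC 0) 0
    have hy : y = y' := by simpa [coin] using congrFun (congrFun hC 0) 1
    subst hx hy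
    exact ⟨h, h1, h2⟩
  · rintro ⟨h, h1, h2⟩
    exact ⟨x, y, h, h1, h2, rfl⟩

theorem exists_eq_smul_escapeVec_iff (hx1 : x ≠ 1) (α β γ : ℂ) :
    (∃ c : ℂ, !₂[α, β, γ] = c • escapeVec x y) ↔
      α * (1 - x) + β * (1 - x - y) = 0 ∧ γ * (1 - x) + β * y = 0 := by
  have hne : (1 - x : ℂ) ≠ 0 := by exact_mod_cast sub_ne_zero.2 hx1.symm
  constructor
  · rintro ⟨c, hc⟩
    have h0 : α = c * (1 - x - y) := by simpa [escapeVec] using congrArg (fun v => v 0) hc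
    have h1 : β = c * -(1 - x) := by simpa [escapeVec] using congrArg (fun v => v 1) hc
    have h2 : γ = c * y := by simpa [escapeVec] using congrArg (fun v => v 2) hc
    subst h0 h1 h2
    constructor <;> ring
  · rintro ⟨hA, hB⟩
    -- The scalar is forced by the middle coordinate `-(1 - x)`.
    refine ⟨-β / (1 - x), ?_⟩
    ext i
    fin_cases i <;> simp [escapeVec] <;> field_simp
    · linear_combination hA
    · ring
    · linear_combination hB

theorem norm_escapeVec (x y : ℝ) :
    ‖escapeVec x y‖ = √((1 - x - y) ^ 2 + (1 - x) ^ 2 + y ^ 2) := by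
  have h1 : ‖(1 - x - y : ℂ)‖ ^ 2 = (1 - x - y) ^ 2 := by
    rw [← ofReal_one, ← ofReal_sub, ← ofReal_sub, norm_real, Real.norm_eq_abs, sq_abs]
  have h2 : ‖(1 - x : ℂ)‖ ^ 2 = (1 - x) ^ 2 := by
    rw [← ofReal_one, ← ofReal_sub, norm_real, Real.norm_eq_abs, sq_abs]
  rw [EuclideanSpace.norm_eq, Fin.sum_univ_three]
  simp only [escapeVec, PiLp.toLp_apply, Matrix.cons_val_zero, Matrix.cons_val_one,
    Matrix.cons_val, norm_neg, h1, h2, norm_real, Real.norm_eq_abs, sq_abs]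

end ThreeStateWalk

theorem mainTheorem3 (x y : ℝ) (hC : ThreeStateWalk.coin x y ∈ ThreeStateWalk.coinsX)
    (hx0 : x ≠ 0) (hx1 : x ≠ 1) (α β γ : ℂ)
    (hnorm : ‖α‖ ^ 2 + ‖β‖ ^ 2 + ‖γ‖ ^ 2 = 1) :
    List.TFAE
      [Filter.Tendsto (fun t : ℕ => ThreeStateWalk.prob (ThreeStateWalk.coin x y) !₂[α, β, γ] 0 t)
          Filter.atTop (nhds 0),
        ∃ c : ℂ, !₂[α, β, γ] = c • ThreeStateWalk.escapeVec x y,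
        ∃ u : ℂ, ‖u‖ = 1 ∧ !₂[α, β, γ] =
          (u / (Real.sqrt ((1 - x - y) ^ 2 + (1 - x) ^ 2 + y ^ 2) : ℂ)) •
            ThreeStateWalk.escapeVec x y,
        α * (1 - x) + β * (1 - x - y) = 0 ∧ γ * (1 - x) + β * y = 0] ∧
    ((¬ ∃ c : ℂ, !₂[α, β, γ] = c • ThreeStateWalk.escapeVec x y) →
      ThreeStateWalk.LocalizesAt (ThreeStateWalk.coin x y) !₂[α, β, γ] 0) := by
  obtain ⟨h, hx, hxle⟩ := ThreeStateWalk.coin_mem_coinsX_iff.1 hC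
  have hxlt := lt_of_le_of_ne hxle hx1
  have hlim := ThreeStateWalk.tendsto_prob h hx hxlt hx0 !₂[α, β, γ]
  have hzero : ThreeStateWalk.limitVec x y !₂[α, β, γ] = 0 ↔
      α * (1 - x) + β * (1 - x - y) = 0 ∧ γ * (1 - x) + β * y = 0 :=
    ThreeStateWalk.limitVec_eq_zero_iff h hx hxlt !₂[α, β, γ]
  have hmult := ThreeStateWalk.exists_eq_smul_escapeVec_iff (y := y) hx1 α β γ
  refine ⟨?_, fun hno => ?_⟩
  · tfae_have 1 ↔ 4 := by
      rw [← hzero]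
      constructor
      · intro h1
        simpa using tendsto_nhds_unique hlim h1
      · intro h0
        simpa [h0] using hlim
    tfae_have 2 ↔ 4 := hmult
    tfae_have 3 → 2 := fun ⟨u, _, hu⟩ => ⟨_, hu⟩
    tfae_have 2 → 3 := by
      rintro ⟨c, hc⟩
      have hpos : 0 < (1 - x - y) ^ 2 + (1 - x) ^ 2 + y ^ 2 := by
        have := sq_pos_of_ne_zero (sub_ne_zero.2 hx1.symm)
        positivity
      have hN : √((1 - x - y) ^ 2 + (1 - x) ^ 2 + y ^ 2) ≠ 0 := (Real.sqrt_pos.2 hpos).ne'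
      have hφ : ‖(!₂[α, β, γ] : ThreeStateWalk.CoinSpace)‖ = 1 := by
        rw [EuclideanSpace.norm_eq, Fin.sum_univ_three]
        simp [hnorm]
      -- The root is `‖escapeVec x y‖`, so this scalar has modulus `‖c • escapeVec x y‖ = 1`.
      refine ⟨c * (√((1 - x - y) ^ 2 + (1 - x) ^ 2 + y ^ 2) : ℝ), ?_, ?_⟩
      · rw [← ThreeStateWalk.norm_escapeVec, norm_mul, Complex.norm_real, norm_norm, ← norm_smul,
          ← hc, hφ]
      · rw [mul_div_cancel_right₀ _ (by exact_mod_cast hN)]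
        exact hc
    tfae_finish
  · refine ⟨_, ?_, hlim⟩
    have : ThreeStateWalk.limitVec x y !₂[α, β, γ] ≠ 0 := fun h0 => hno (hmult.2 (hzero.1 h0))
    positivity
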